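/- Let $H$ be an infinite-dimensional separable complex Hilbert space. Then there is a bounded linear operator $T : H \to H$ which is syndetically hypercyclic but not chaotic. Here, for nonempty open sets $U, V \subseteq H$, put $N(U,V) = \{n \in \mathbb{N} : T^n U \cap V \neq \emptyset\}$. The operator $T$ is called *hypercyclic* if it has dense range and is topologically transitive, i.e. $N(U,V) \neq \emptyset$ for all nonempty open $U, V$. It is called *syndetically hypercyclic* if it is hypercyclic and every set $N(U,V)$, with $U, V$ nonempty and open, is syndetic, i.e. has uniformly bounded gaps in $\mathbb{N}$: there is $L$ (depending on $U,V$) such that every interval $\{n, n+1, \dots, n+L\}$ with $n \in \mathbb{N}$ meets $N(U,V)$. It is called *chaotic* if it is hypercyclic and its set of periodic points $\{x \in H : T^n x = x \text{ for some } n \geq 1\}$ is dense in $H$. -/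

import Mathlib

namespace LinearDynamics

/-- The return-time set `N(U, V) = {n ∈ ℕ : Tⁿ U ∩ V ≠ ∅}`. -/
def returnTimes {X : Type*} (T : X → X) (U V : Set X) : Set ℕ :=
  {n | ((T^[n] '' U) ∩ V).Nonempty}

/-- A set of natural numbers is syndetic if its gaps are uniformly bounded: for some `L`, every
interval `[n, n + L]` meets the set. -/
def Syndetic (S : Set ℕ) : Prop :=
  ∃ L : ℕ, ∀ n : ℕ, ∃ m ∈ S, n ≤ m ∧ m ≤ n + L

/-- Topological transitivity of a self-map. -/
def TopTransitive {X : Type*} [TopologicalSpace X] (T : X → X) : Prop :=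
  ∀ U V : Set X, IsOpen U → U.Nonempty → IsOpen V → V.Nonempty →
    (returnTimes T U V).Nonempty

/-- Syndetic transitivity: all return-time sets of nonempty open sets are syndetic. -/
def SyndeticallyTransitive {X : Type*} [TopologicalSpace X] (T : X → X) : Prop :=
  ∀ U V : Set X, IsOpen U → U.Nonempty → IsOpen V → V.Nonempty →
    Syndetic (returnTimes T U V)

variable {X : Type*} [NormedAddCommGroup X] [NormedSpace ℂ X]

/-- A bounded operator is hypercyclic if it has dense range (so that it defines a linear system)
and this system is topologically transitive. -/
def Hypercyclic (T : X →L[ℂ] X) : Prop :=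
  DenseRange T ∧ TopTransitive T

/-- A hypercyclic operator whose linear system is syndetically transitive. -/
def SyndeticallyHypercyclic (T : X →L[ℂ] X) : Prop :=
  Hypercyclic T ∧ SyndeticallyTransitive T

/-- (Devaney) chaos: topological transitivity together with density of the periodic points. -/
def Chaotic (T : X →L[ℂ] X) : Prop :=
  Hypercyclic T ∧ Dense (Function.periodicPts T)

end LinearDynamics

namespace LinearDynamics

open Filter Topology Submodule

/-! In an orthonormal basis indexed by `ℕ`, take the weighted backward shift with weights `s (n + 1)
/ s n`, where `s n = √(n + 1)`. Weight products telescope to `s (n + k) / s n`. As `s` tends to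
infinity, Kitai's criterion holds on finite combinations of basis vectors, so return-time sets are
even cofinite. A vector `x` of period `p` satisfies `s (n + p * j) * |x (n + p * j)| = s n * |x n|`;
since `∑ 1 / (n + p * j + 1)` diverges, square-summability forces `x = 0`. -/

/-- The weighted backward shift `(x_n) ↦ (w_n x_{n+1})` on `ℓ²(ℕ)`, for bounded weights. -/
noncomputable def weightedShift (w : ℕ → ℂ) (C : ℝ) (hw : ∀ n, ‖w n‖ ≤ C) :
    lp (fun _ : ℕ => ℂ) 2 →L[ℂ] lp (fun _ : ℕ => ℂ) 2 :=
  have hb (f : lp (fun _ : ℕ => ℂ) 2) (n : ℕ) :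
      ‖w n * f (n + 1)‖ ^ (2 : ENNReal).toReal ≤ C ^ 2 * ‖f (n + 1)‖ ^ (2 : ENNReal).toReal := by
    simp only [ENNReal.toReal_ofNat, Real.rpow_ofNat, norm_mul, mul_pow]
    gcongr
    exact hw n
  have hs (f : lp (fun _ : ℕ => ℂ) 2) :
      Summable fun n => ‖f n‖ ^ (2 : ENNReal).toReal := (lp.memℓp f).summable (by simp)
  have hs' (f : lp (fun _ : ℕ => ℂ) 2) :
      Summable fun n => ‖f (n + 1)‖ ^ (2 : ENNReal).toReal := (summable_nat_add_iff 1).2 (hs f)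
  have hm (f : lp (fun _ : ℕ => ℂ) 2) : Memℓp (fun n => w n * f (n + 1)) 2 :=
    memℓp_gen (Summable.of_nonneg_of_le (fun n => by positivity) (hb f) ((hs' f).mul_left _))
  LinearMap.mkContinuous
    { toFun := fun f => ⟨fun n => w n * f (n + 1), hm f⟩
      map_add' := fun f g => by ext n; exact mul_add _ _ _
      map_smul' := fun c f => by ext n; simp [mul_left_comm] } C fun f => by
    have hC : 0 ≤ C := (norm_nonneg _).trans (hw 0)
    refine lp.norm_le_of_tsum_le (by simp) (by positivity) ?_
    calc ∑' n, ‖w n * f (n + 1)‖ ^ (2 : ENNReal).toReal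
        ≤ ∑' n, C ^ 2 * ‖f (n + 1)‖ ^ (2 : ENNReal).toReal :=
          ((lp.memℓp ⟨_, hm f⟩).summable (by simp)).tsum_le_tsum (hb f) ((hs' f).mul_left _)
      _ = C ^ 2 * ∑' n, ‖f (n + 1)‖ ^ (2 : ENNReal).toReal := tsum_mul_left
      _ ≤ C ^ 2 * ∑' n, ‖f n‖ ^ (2 : ENNReal).toReal := by
          refine mul_le_mul_of_nonneg_left ?_ (sq_nonneg C)
          rw [(hs f).tsum_eq_zero_add]
          exact le_add_of_nonneg_left (by positivity)
      _ = (C * ‖f‖) ^ (2 : ENNReal).toReal := by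
          rw [Real.mul_rpow hC (norm_nonneg _), lp.norm_rpow_eq_tsum (by simp) f]
          simp

theorem weightedShift_apply (w : ℕ → ℂ) (C : ℝ) (hw : ∀ n, ‖w n‖ ≤ C)
    (f : lp (fun _ : ℕ => ℂ) 2) (n : ℕ) : weightedShift w C hw f n = w n * f (n + 1) := rfl

section Basis

variable {H : Type*} [NormedAddCommGroup H] [InnerProductSpace ℂ H]

/-- The members of an orthonormal family in a separable space are countably many. -/
theorem countable_of_orthonormal [TopologicalSpace.SeparableSpace H] {ι : Type*} {v : ι → H}
    (hv : Orthonormal ℂ v) : Countable ι := by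
  refine Pairwise.countable_of_isOpen_disjoint (s := fun i => Metric.ball (v i) (1 / 2))
    (fun i j hij => Metric.ball_disjoint_ball ?_) (fun i => Metric.isOpen_ball)
    (fun i => Metric.nonempty_ball.2 (by norm_num))
  have h : ‖v i - v j‖ ^ 2 = 2 := by
    rw [@norm_sub_sq ℂ, hv.1 i, hv.1 j, hv.2 hij]
    norm_num
  rw [dist_eq_norm]
  nlinarith [norm_nonneg (v i - v j)]

/-- An infinite-dimensional separable Hilbert space has a Hilbert basis indexed by `ℕ`. -/
theorem exists_hilbertBasis_nat [CompleteSpace H] [TopologicalSpace.SeparableSpace H]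
    (hH : ¬ FiniteDimensional ℂ H) : Nonempty (HilbertBasis ℕ ℂ H) := by
  obtain ⟨s, b, -⟩ := exists_hilbertBasis ℂ H
  have : Countable s := countable_of_orthonormal b.orthonormal
  have : Infinite s := by
    refine not_finite_iff_infinite.1 fun _ => hH ?_
    have := Fintype.ofFinite s
    exact b.toOrthonormalBasis.toBasis.finiteDimensional_of_finite
  obtain ⟨e⟩ := nonempty_equiv_of_countable (α := ℕ) (β := s)
  refine ⟨HilbertBasis.mk (b.orthonormal.comp e e.injective) ?_⟩
  rw [e.surjective.range_comp, b.dense_span]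

theorem dense_of_basis_mem (b : HilbertBasis ℕ ℂ H) (D : Submodule ℂ H) (h : ∀ n, b n ∈ D) :
    Dense (D : Set H) := by
  rw [Submodule.dense_iff_topologicalClosure_eq_top, eq_top_iff, ← b.dense_span]
  exact Submodule.topologicalClosure_mono (span_le.2 (Set.range_subset_iff.2 h))

end Basis

section Criterion

variable {H : Type*} [NormedAddCommGroup H] [InnerProductSpace ℂ H]

/-- The vectors whose orbit is eventually zero. -/
def eventuallyNull (T : H →L[ℂ] H) : Submodule ℂ H where
  carrier := {x | ∀ᶠ k in atTop, T^[k] x = 0}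
  zero_mem' := .of_forall fun k => iterate_map_zero T k
  add_mem' := fun {x y} hx hy => by
    filter_upwards [hx, hy] with k h₁ h₂
    rw [iterate_map_add, h₁, h₂, add_zero]
  smul_mem' := fun c x hx => by
    filter_upwards [hx] with k h
    rw [(Function.Commute.iterate_left (fun y => T.map_smul c y) k : Function.Commute _ _).eq, h,
      smul_zero]

/-- The vectors having backward orbits that tend to zero. -/
def backwardNull (T : H →L[ℂ] H) : Submodule ℂ H where
  carrier := {x | ∃ y : ℕ → H, Tendsto y atTop (𝓝 0) ∧ ∀ k, T^[k] (y k) = x}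
  zero_mem' := ⟨0, tendsto_const_nhds, fun k => iterate_map_zero T k⟩
  add_mem' := by
    rintro _ _ ⟨y, hy, h⟩ ⟨z, hz, h'⟩
    exact ⟨y + z, add_zero (0 : H) ▸ hy.add hz, fun k => by
      rw [Pi.add_apply, iterate_map_add, h, h']⟩
  smul_mem' := by
    rintro c _ ⟨y, hy, h⟩
    refine ⟨c • y, smul_zero (A := H) c ▸ hy.const_smul c, fun k => ?_⟩
    rw [Pi.smul_apply, (Function.Commute.iterate_left (fun y => T.map_smul c y) k :
      Function.Commute _ _).eq, h]

/-- Kitai's criterion: return-time sets are cofinite. -/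
theorem eventually_mem_returnTimes {T : H →L[ℂ] H} (h₁ : Dense (eventuallyNull T : Set H))
    (h₂ : Dense (backwardNull T : Set H)) {U V : Set H} (hU : IsOpen U) (hU' : U.Nonempty)
    (hV : IsOpen V) (hV' : V.Nonempty) : ∀ᶠ k in atTop, k ∈ returnTimes T U V := by
  obtain ⟨u, hu, huU⟩ := h₁.exists_mem_open hU hU'
  obtain ⟨v, ⟨y, hy, hyv⟩, hvV⟩ := h₂.exists_mem_open hV hV'
  -- The perturbed point `u + y k` is eventually in `U`, and `T^[k]` sends it to `v` once `u` has
  -- been killed.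
  have hlim : Tendsto (fun k => u + y k) atTop (𝓝 u) := by simpa using hy.const_add u
  filter_upwards [hu, hlim.eventually (hU.mem_nhds huU)] with k hk hkU
  exact ⟨v, ⟨u + y k, hkU, by rw [iterate_map_add, hk, hyv, zero_add]⟩, hvV⟩

theorem syndetic_of_eventually {S : Set ℕ} (h : ∀ᶠ k in atTop, k ∈ S) : Syndetic S := by
  obtain ⟨N, hN⟩ := eventually_atTop.1 h
  exact ⟨N, fun n => ⟨n + N, hN _ (Nat.le_add_left N n), Nat.le_add_right n N, le_rfl⟩⟩

theorem syndeticallyHypercyclic_of_dense {T : H →L[ℂ] H} (h₁ : Dense (eventuallyNull T : Set H))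
    (h₂ : Dense (backwardNull T : Set H)) : SyndeticallyHypercyclic T := by
  refine ⟨⟨h₂.mono ?_, fun U V hU hU' hV hV' =>
    (eventually_mem_returnTimes h₁ h₂ hU hU' hV hV').exists⟩, fun U V hU hU' hV hV' =>
    syndetic_of_eventually (eventually_mem_returnTimes h₁ h₂ hU hU' hV hV')⟩
  -- Dense range: `y 1` is a preimage of the given vector.
  rintro _ ⟨y, -, hy⟩
  exact ⟨y 1, hy 1⟩

end Criterion

section Shift

variable {H : Type*} [NormedAddCommGroup H] [InnerProductSpace ℂ H] {b : HilbertBasis ℕ ℂ H}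
  {T : H →L[ℂ] H} {s : ℕ → ℝ}

theorem exists_shift (b : HilbertBasis ℕ ℂ H) {s : ℕ → ℝ} (C : ℝ)
    (hC : ∀ n, |s (n + 1) / s n| ≤ C) :
    ∃ T : H →L[ℂ] H, ∀ x n, b.repr (T x) n = ((s (n + 1) / s n : ℝ) : ℂ) * b.repr x (n + 1) :=
  ⟨b.repr.symm.toContinuousLinearEquiv.toContinuousLinearMap ∘L
    weightedShift (fun n => ((s (n + 1) / s n : ℝ) : ℂ)) C
      (fun n => by simpa only [Complex.norm_real, Real.norm_eq_abs] using hC n) ∘L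
    b.repr.toContinuousLinearEquiv.toContinuousLinearMap, fun x n => by
      simp [weightedShift_apply]⟩

theorem repr_iterate_shift (hs : ∀ n, s n ≠ 0)
    (hT : ∀ x n, b.repr (T x) n = ((s (n + 1) / s n : ℝ) : ℂ) * b.repr x (n + 1)) (k n : ℕ)
    (x : H) : b.repr (T^[k] x) n = ((s (n + k) / s n : ℝ) : ℂ) * b.repr x (n + k) := by
  induction k generalizing x with
  | zero => simp [hs n]
  | succ k ih =>
    rw [Function.iterate_succ_apply, ih, hT, ← mul_assoc, ← Complex.ofReal_mul, add_assoc,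
      mul_comm (s (n + k) / s n), div_mul_div_cancel₀ (hs _)]

theorem syndeticallyHypercyclic_shift (hs : ∀ n, s n ≠ 0)
    (hT : ∀ x n, b.repr (T x) n = ((s (n + 1) / s n : ℝ) : ℂ) * b.repr x (n + 1))
    (hlim : Tendsto s atTop atTop) : SyndeticallyHypercyclic T := by
  refine syndeticallyHypercyclic_of_dense (dense_of_basis_mem b _ fun n => ?_)
    (dense_of_basis_mem b _ fun n => ?_)
  · filter_upwards [eventually_gt_atTop n] with k hk
    apply b.repr.injective
    ext m
    rw [repr_iterate_shift hs hT, b.repr_self, lp.single_apply_ne _ _ _ (by omega)]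
    simp
  -- The coefficient undoes the weights met on the way from `n + k` down to `n`.
  · refine ⟨fun k => ((s n / s (n + k) : ℝ) : ℂ) • b (n + k), ?_, fun k => ?_⟩
    · rw [tendsto_zero_iff_norm_tendsto_zero]
      have h : Tendsto (fun k => |s n / s (n + k)|) atTop (𝓝 |0|) :=
        (Tendsto.const_div_atTop
          (hlim.comp (tendsto_atTop_mono (fun k => Nat.le_add_left k n) tendsto_id)) _).abs
      simpa only [norm_smul, Complex.norm_real, Real.norm_eq_abs, b.orthonormal.1, mul_one,
        abs_zero] using h
    · apply b.repr.injective
      ext m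
      rw [repr_iterate_shift hs hT, map_smul, b.repr_self, b.repr_self, lp.coeFn_smul,
        Pi.smul_apply]
      rcases eq_or_ne m n with rfl | hmn
      · simp only [lp.single_apply_self, smul_eq_mul, mul_one]
        rw [← Complex.ofReal_mul, div_mul_div_cancel₀ (hs _), div_self (hs _), Complex.ofReal_one]
      · rw [lp.single_apply_ne _ _ _ (by omega), lp.single_apply_ne _ _ _ hmn]
        simp

theorem eq_zero_of_mem_periodicPts_shift (hs : ∀ n, s n ≠ 0)
    (hT : ∀ x n, b.repr (T x) n = ((s (n + 1) / s n : ℝ) : ℂ) * b.repr x (n + 1))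
    (hsum : ∀ n p, 0 < p → ¬ Summable fun j : ℕ => (s (n + p * j) ^ 2)⁻¹) {x : H}
    (hx : x ∈ Function.periodicPts T) : x = 0 := by
  obtain ⟨p, hp, hx⟩ := hx
  apply b.repr.injective
  ext n
  rw [map_zero, lp.coeFn_zero, Pi.zero_apply]
  by_contra hn
  refine hsum n p hp ?_
  have hsq : Summable fun m => ‖b.repr x m‖ ^ 2 := by
    simpa using (lp.memℓp (b.repr x)).summable (by simp)
  have hinj : Function.Injective fun j => n + p * j := fun i j hij =>
    Nat.eq_of_mul_eq_mul_left hp (Nat.add_left_cancel hij)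
  -- This factor normalises the terms along the progression to exactly `(s (n + p * j) ^ 2)⁻¹`.
  have h := (hsq.comp_injective hinj).mul_left ((s n ^ 2)⁻¹ * (‖b.repr x n‖ ^ 2)⁻¹)
  refine h.congr fun j => ?_
  have hj : T^[p * j] x = x := (hx.mul_const j : Function.IsPeriodicPt T (p * j) x)
  have hval := congrArg norm (repr_iterate_shift hs hT (p * j) n x)
  rw [hj, norm_mul, Complex.norm_real, Real.norm_eq_abs] at hval
  have hval' : ‖b.repr x n‖ ^ 2 = s (n + p * j) ^ 2 / s n ^ 2 * ‖b.repr x (n + p * j)‖ ^ 2 := by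
    rw [hval, mul_pow, sq_abs, div_pow]
  have h0 : ‖b.repr x n‖ ^ 2 ≠ 0 := pow_ne_zero _ (norm_ne_zero_iff.2 hn)
  have h1 := hs n
  have h2 := hs (n + p * j)
  rw [Function.comp_apply, ← mul_right_inj' h0]
  field_simp
  rw [hval']
  field_simp

end Shift

/-- Comparison with the harmonic series: `n + p * j + 1 ≤ (n + p + 1) * (j + 1)`. -/
theorem not_summable_inv_sqrt_sq (n p : ℕ) :
    ¬ Summable fun j : ℕ => (√((n + p * j : ℕ) + 1 : ℝ) ^ 2)⁻¹ := by
  intro h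
  have h' : Summable fun j : ℕ => (((j + 1 : ℕ) : ℝ))⁻¹ := by
    refine Summable.of_nonneg_of_le (fun j => by positivity) (fun j => ?_)
      (h.mul_left ((n + p + 1 : ℕ) : ℝ))
    rw [Real.sq_sqrt (by positivity), ← div_eq_mul_inv, inv_eq_one_div,
      div_le_div_iff₀ (by positivity) (by positivity)]
    norm_cast
    nlinarith [Nat.zero_le (n * j), Nat.zero_le (p * j)]
  exact Real.not_summable_natCast_inv ((summable_nat_add_iff 1).1 h')

end LinearDynamics

open LinearDynamics in
theorem mainTheorem11 (H : Type*) [NormedAddCommGroup H] [InnerProductSpace ℂ H]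
    [CompleteSpace H] [TopologicalSpace.SeparableSpace H] (hH : ¬ FiniteDimensional ℂ H) :
    ∃ T : H →L[ℂ] H,
      LinearDynamics.SyndeticallyHypercyclic T ∧ ¬ LinearDynamics.Chaotic T := by
  obtain ⟨b⟩ := exists_hilbertBasis_nat hH
  let s : ℕ → ℝ := fun n => √((n : ℝ) + 1)
  have hs (n : ℕ) : s n ≠ 0 := (Real.sqrt_pos.2 (by positivity)).ne'
  -- The squared weight `(n + 2) / (n + 1)` is largest at `n = 0`, hence the bound `√2`.
  obtain ⟨T, hT⟩ := exists_shift b (s := s) √2 fun n => by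
    rw [← Real.sqrt_div (by positivity), abs_of_nonneg (Real.sqrt_nonneg _)]
    refine Real.sqrt_le_sqrt ?_
    rw [div_le_iff₀ (by positivity)]
    push_cast
    linarith [(Nat.cast_nonneg n : (0 : ℝ) ≤ n)]
  refine ⟨T, syndeticallyHypercyclic_shift hs hT ?_, fun hchaos => ?_⟩
  · exact Real.tendsto_sqrt_atTop.comp
      (Filter.tendsto_atTop_add_const_right _ _ tendsto_natCast_atTop_atTop)
  · have hsub : Function.periodicPts T ⊆ {0} := fun x hx =>
      eq_zero_of_mem_periodicPts_shift hs hT (fun n p _ => not_summable_inv_sqrt_sq n p) hx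
    have hb : b 0 ∈ closure ({0} : Set H) := (hchaos.2.mono hsub) (b 0)
    rw [closure_singleton] at hb
    exact b.orthonormal.ne_zero 0 hb
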